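/- Let $\mathbf{k}$ be an algebraically closed field of characteristic zero and let $(\mathcal{P},\preceq)$ be a finite poset. Let $\mathfrak{g}^{\prec}(\mathcal{P})$ be the nilpotent Lie poset algebra of $\mathcal{P}$, i.e. the Lie algebra over $\mathbf{k}$ spanned by the matrix units $E_{p,q}$ with $p,q\in\mathcal{P}$ and $p\prec q$ (equivalently, all $\mathcal{P}\times\mathcal{P}$ matrices whose $(p,q)$-entry can be nonzero only if $p\prec q$), with bracket $[X,Y]=XY-YX$. The index of a finite-dimensional Lie algebra $\mathfrak{g}$ is $$\operatorname{ind}\mathfrak{g}=\min_{F\in\mathfrak{g}^*}\dim\ker(B_F),\qquad B_F(x,y)=F([x,y]).$$ Let $Rel(\mathcal{P})=\{(p,q)\in\mathcal{P}\times\mathcal{P}: p\prec q\}$ be the set of strict relations of $\mathcal{P}$, let $Ext(\mathcal{P})$ be the set of elements of $\mathcal{P}$ that are minimal or maximal, and for $p\in\mathcal{P}$ let $D(\mathcal{P},p)=|\{q\in\mathcal{P}:q\prec p\}|$ and $U(\mathcal{P},p)=|\{q\in\mathcal{P}:p\prec q\}|$. Then $$\operatorname{ind}\mathfrak{g}^{\prec}(\mathcal{P})=|Rel(\mathcal{P})|-2\sum_{p\in\mathcal{P}\setminus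 Ext(\mathcal{P})}\min\bigl(D(\mathcal{P},p),U(\mathcal{P},p)\bigr).$$ -/

import Mathlib

attribute [local instance] LieRing.ofAssociativeRing

namespace LiePoset

/-- The Kirillov form `B_F(x, y) = F([x, y])` attached to a linear functional `F` on a
Lie algebra `g`. -/
def kirillovForm {k g : Type*} [Field k] [LieRing g] [LieAlgebra k g]
    (F : Module.Dual k g) : LinearMap.BilinForm k g :=
  LinearMap.mk₂ k (fun x y => F ⁅x, y⁆)
    (fun x y z => by simp) (fun c x y => by simp)
    (fun x y z => by simp) (fun c x y => by simp)

/-- The index of a finite-dimensional Lie algebra `g` over a field `k`: the minimum of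
`dim ker B_F` over all linear functionals `F` on `g`. -/
noncomputable def index (k g : Type*) [Field k] [LieRing g] [LieAlgebra k g]
    [FiniteDimensional k g] : ℕ :=
  sInf (Set.range fun F : Module.Dual k g =>
    Module.finrank k (LinearMap.ker (kirillovForm F)))

/-- The nilpotent Lie poset algebra of a finite poset `P` over `k`: the Lie algebra (under
the commutator bracket) of the `P × P` matrices whose `(p, q)` entry can be nonzero only
if `p < q`. -/
def nilpotentLiePosetAlgebra (k P : Type*) [Field k] [Fintype P] [DecidableEq P]
    [PartialOrder P] : LieSubalgebra k (Matrix P P k) where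
  carrier := {X | ∀ p q : P, ¬ p < q → X p q = 0}
  add_mem' := by
    intro X Y hX hY p q h
    simp [hX p q h, hY p q h]
  zero_mem' := by
    intro p q _
    rfl
  smul_mem' := by
    intro c X hX p q h
    simp [hX p q h]
  lie_mem' := by
    have key : ∀ X Y : Matrix P P k, (∀ p q : P, ¬ p < q → X p q = 0) →
        (∀ p q : P, ¬ p < q → Y p q = 0) → ∀ p q : P, ¬ p < q → (X * Y) p q = 0 := by
      intro X Y hX hY p q h
      rw [Matrix.mul_apply]
      refine Finset.sum_eq_zero fun r _ => ?_
      by_cases hpr : p < r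
      · rw [hY r q fun hrq => h (hpr.trans hrq), mul_zero]
      · rw [hX p r hpr, zero_mul]
    intro X Y hX hY p q h
    rw [Ring.lie_def, Matrix.sub_apply, key X Y hX hY p q h, key Y X hY hX p q h, sub_zero]

/-- The nilpotent Lie poset algebra is the span of the matrix units `E_{p,q}` with `p < q`. -/
theorem nilpotentLiePosetAlgebra_eq_span (k P : Type*) [Field k] [Fintype P] [DecidableEq P]
    [PartialOrder P] :
    (nilpotentLiePosetAlgebra k P).toSubmodule =
      Submodule.span k {X | ∃ p q : P, p < q ∧ X = Matrix.single p q (1 : k)} := by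
  apply le_antisymm
  · intro X hX
    rw [Matrix.matrix_eq_sum_single X]
    refine Submodule.sum_mem _ fun p _ => Submodule.sum_mem _ fun q _ => ?_
    by_cases h : p < q
    · have : Matrix.single p q (X p q) = X p q • Matrix.single p q (1 : k) := by simp
      rw [this]
      exact Submodule.smul_mem _ _ (Submodule.subset_span ⟨p, q, h, rfl⟩)
    · have h0 : X p q = 0 := hX p q h
      simp [h0]
  · rw [Submodule.span_le]
    rintro _ ⟨p, q, h, rfl⟩ r s hrs
    apply Matrix.single_apply_of_ne
    rintro ⟨rfl, rfl⟩
    exact hrs h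

/-- The set of strict relations `p < q` of a poset. -/
def strictRel (P : Type*) [PartialOrder P] : Set (P × P) := {x | x.1 < x.2}

/-- The set of minimal and maximal elements of a poset. -/
def extremal (P : Type*) [PartialOrder P] : Set P := {p | IsMin p ∨ IsMax p}

/-- The number of elements strictly below `p`. -/
noncomputable def numBelow {P : Type*} [PartialOrder P] (p : P) : ℕ := {q : P | q < p}.ncard

/-- The number of elements strictly above `p`. -/
noncomputable def numAbove {P : Type*} [PartialOrder P] (p : P) : ℕ := {q : P | p < q}.ncard

end LiePoset

/-! Write `F` with coefficients `c p q`. Grouped by the middle element `r`, the form `B_F` pairs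
entries `(p, r)` with entries `(r, q)`, so each `r` contributes rank at most `2 * min (numBelow r)
(numAbove r)`. This bounds every kernel from below (`finrank_le_finrank_ker_kirillovForm`).

Equality is attained by the Cauchy functional `c p q = 1 / (f p + f q)`. For `d = min (numBelow p)
(numAbove p)`, choose `d` elements `A p` below `p`, each with fewer than `d` elements below it, and
`B p` dually. The positions `(a, p)` with `a ∈ A p` and `(p, b)` with `b ∈ B p` are all distinct. A
kernel element supported on them is zero: in a suitable order on blocks, the equations `B_F(x,
E_{p,b}) = 0` and `B_F(x, E_{a,p}) = 0` reduce to invertible Cauchy systems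
(`eq_zero_of_mem_ker_of_support`). Hence the kernel embeds in the remaining coordinates. -/

namespace LiePoset

open Finset

/-! ### Counting below and above; the potential ordering the elimination -/

section Counting

variable {P : Type*} [Fintype P] [PartialOrder P]

theorem numBelow_lt_numBelow {a b : P} (h : a < b) : numBelow a < numBelow b :=
  Set.ncard_lt_ncard ⟨fun _ hc => lt_trans hc h, fun hs => lt_irrefl a (hs h)⟩

theorem numAbove_lt_numAbove {a b : P} (h : a < b) : numAbove b < numAbove a :=
  Set.ncard_lt_ncard ⟨fun _ hc => lt_trans h hc, fun hs => lt_irrefl b (hs h)⟩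

theorem numBelow_le_card (p : P) : numBelow p ≤ Fintype.card P := by
  rw [← Nat.card_eq_fintype_card]; exact Set.ncard_le_card _

theorem numAbove_le_card (p : P) : numAbove p ≤ Fintype.card P := by
  rw [← Nat.card_eq_fintype_card]; exact Set.ncard_le_card _

/-- An element with at least `d` elements above it has at least `d` elements above it which
themselves have fewer than `d` elements above them. -/
theorem exists_finset_above (p : P) {d : ℕ} (hd : d ≤ numAbove p) :
    ∃ B : Finset P, (∀ b ∈ B, p < b ∧ numAbove b < d) ∧ #B = d := by
  classical
  -- By maximality of `q`, everything above `q` has fewer than `d` elements above it, so any `d` of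
  -- these will do.
  obtain ⟨q, hpq, hq⟩ := (Set.toFinite {q : P | d ≤ numAbove q}).exists_le_maximal hd
  have hcard : d ≤ #{b : P | q < b} := by
    have h := hq.prop
    rw [Set.mem_ofPred_eq, numAbove, Set.ncard_eq_toFinset_card'] at h
    simpa using h
  obtain ⟨B, hB, hBd⟩ := exists_subset_card_eq hcard
  refine ⟨B, fun b hb => ?_, hBd⟩
  have hqb : q < b := by simpa using hB hb
  refine ⟨hpq.trans_lt hqb, ?_⟩
  by_contra! h
  exact hq.not_gt h hqb

theorem exists_finset_below (p : P) {d : ℕ} (hd : d ≤ numBelow p) :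
    ∃ A : Finset P, (∀ a ∈ A, a < p ∧ numBelow a < d) ∧ #A = d :=
  exists_finset_above (P := Pᵒᵈ) (OrderDual.toDual p) hd

/-- A potential on the poset, which is large and positive on elements with at most as many
elements below as above, and negative on the others. -/
noncomputable def potential (p : P) : ℤ :=
  if numBelow p ≤ numAbove p then (Fintype.card P + 1 : ℤ) - numBelow p
  else numAbove p - (Fintype.card P + 1 : ℤ)

theorem potential_le (p : P) : potential p ≤ Fintype.card P + 1 := by
  have := numAbove_le_card p
  unfold potential; split_ifs <;> omega

theorem le_potential (p : P) : -(Fintype.card P + 1 : ℤ) ≤ potential p := by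
  have := numBelow_le_card p
  unfold potential; split_ifs <;> omega

/-- The hypotheses force `y` into the positive branch; if `z` is in the negative one, the shifts
cancel, leaving `numAbove z - numBelow y`. This and its dual make the elimination order
well-founded. -/
theorem potential_add_pos {y z : P} (h : y < z) (hyz : numBelow y < numAbove z) :
    0 < potential y + potential z := by
  have h1 := numAbove_lt_numAbove h
  have h2 := numBelow_le_card y
  have h3 := numBelow_le_card z
  unfold potential; split_ifs <;> omega

theorem potential_add_neg {y z : P} (h : y < z) (hyz : numAbove z < numBelow y) :
    potential y + potential z < 0 := by
  have h1 := numBelow_lt_numBelow h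
  have h2 := numAbove_le_card y
  have h3 := numAbove_le_card z
  unfold potential; split_ifs <;> omega

/-- The elements below `p`, or those above `p`, whichever are fewer. -/
noncomputable def smallerSide (p : P) : Finset P :=
  open Classical in
  if numBelow p ≤ numAbove p then univ.filter (· < p) else univ.filter (p < ·)

theorem card_smallerSide (p : P) : #(smallerSide p) = min (numBelow p) (numAbove p) := by
  classical
  have h1 : #{q | q < p} = numBelow p := by
    rw [numBelow, Set.ncard_eq_toFinset_card']; simp
  have h2 : #{q | p < q} = numAbove p := by
    rw [numAbove, Set.ncard_eq_toFinset_card']; simp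
  unfold smallerSide
  split_ifs with h
  · rw [min_eq_left h, ← h1]
  · rw [min_eq_right (not_le.1 h).le, ← h2]

end Counting

/-- Every submatrix of the Cauchy matrix `1 / (f a + f b)` with at least as many columns as rows
has linearly independent rows. -/
theorem eq_zero_of_sum_cauchy_eq_zero {k P : Type*} [Field k] {f : P → k}
    (hf : Function.Injective f) (hne : ∀ a b, f a + f b ≠ 0) {A B : Finset P} (hAB : #A ≤ #B)
    {v : P → k} (hv : ∀ b ∈ B, ∑ a ∈ A, (f a + f b)⁻¹ * v a = 0) : ∀ a ∈ A, v a = 0 := by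
  classical
  -- The numerator of `∑ v a / (X + f a)`: it vanishes at each `f b`, and its value at `-f a`
  -- isolates `v a`.
  let Q : Polynomial k := ∑ a ∈ A, Polynomial.C (v a) * ∏ c ∈ A.erase a,
    (Polynomial.X + Polynomial.C (f c))
  have hdeg : Q.degree < #B := by
    refine lt_of_lt_of_le ?_ (Nat.cast_le.2 hAB)
    refine (Polynomial.degree_sum_le _ _).trans_lt ((Finset.sup_lt_iff (WithBot.bot_lt_coe _)).2 ?_)
    intro a ha
    refine ((Polynomial.degree_mul_le _ _).trans
      (add_le_add_left Polynomial.degree_C_le _)).trans_lt ?_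
    rw [zero_add, Polynomial.degree_prod]
    simp only [Polynomial.degree_X_add_C, sum_const, nsmul_eq_mul, mul_one]
    exact Nat.cast_lt.2 (card_erase_lt_of_mem ha)
  have hQ : Q = 0 := by
    refine Polynomial.eq_zero_of_degree_lt_of_eval_finset_eq_zero (s := B.image f) ?_ ?_
    · rwa [card_image_of_injective _ hf]
    · intro y hy
      obtain ⟨b, hb, rfl⟩ := mem_image.1 hy
      have : Q.eval (f b) = (∏ c ∈ A, (f c + f b)) * ∑ a ∈ A, (f a + f b)⁻¹ * v a := by
        simp only [Q, Polynomial.eval_finsetSum, Polynomial.eval_mul, Polynomial.eval_C,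
          Polynomial.eval_prod, Polynomial.eval_add, Polynomial.eval_X, mul_sum]
        refine sum_congr rfl fun a ha => ?_
        rw [← mul_prod_erase A _ ha]
        have := hne a b
        simp only [add_comm (f b)]
        field_simp
      rw [this, hv b hb, mul_zero]
  intro a ha
  have h0 : Q.eval (-f a) = 0 := by rw [hQ, Polynomial.eval_zero]
  simp only [Q, Polynomial.eval_finsetSum, Polynomial.eval_mul, Polynomial.eval_C,
    Polynomial.eval_prod, Polynomial.eval_add, Polynomial.eval_X] at h0
  rw [sum_eq_single_of_mem a ha] at h0
  · refine (mul_eq_zero.1 h0).resolve_right (prod_ne_zero_iff.2 fun c hc => ?_)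
    rw [neg_add_eq_sub, sub_ne_zero]
    exact fun h => (mem_erase.1 hc).1 (hf h)
  · intro c _ hca
    rw [prod_eq_zero (mem_erase.2 ⟨hca.symm, ha⟩) (neg_add_cancel _), mul_zero]

/-! ### Matrix-unit coordinates and the Kirillov form -/

section Algebra

variable {k P : Type*} [Field k] [Fintype P] [DecidableEq P] [PartialOrder P]

/-- The `(p, q)` entry as a linear functional on the nilpotent Lie poset algebra. -/
def entry (k : Type*) [Field k] (p q : P) : Module.Dual k (nilpotentLiePosetAlgebra k P) :=
  LinearMap.proj q ∘ₗ LinearMap.proj (φ := fun _ : P => P → k) p ∘ₗ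
    (nilpotentLiePosetAlgebra k P).toSubmodule.subtype

theorem entry_apply (p q : P) (x : nilpotentLiePosetAlgebra k P) :
    entry k p q x = (x : Matrix P P k) p q := rfl

theorem entry_eq_zero {p q : P} (h : ¬ p < q) (x : nilpotentLiePosetAlgebra k P) :
    entry k p q x = 0 := x.2 p q h

theorem ext_entry {x y : nilpotentLiePosetAlgebra k P} (h : ∀ p q, entry k p q x = entry k p q y) :
    x = y :=
  Subtype.ext (Matrix.ext h)

/-- The matrix unit `E_{p,q}` for `p < q`. -/
def unit (k : Type*) [Field k] {p q : P} (h : p < q) : nilpotentLiePosetAlgebra k P :=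
  ⟨Matrix.single p q 1, fun r s hrs => Matrix.single_apply_of_ne _ _ _ _ _ (by
    rintro ⟨rfl, rfl⟩; exact hrs h)⟩

theorem entry_unit {p q : P} (h : p < q) (r s : P) :
    entry k r s (unit k h) = if p = r ∧ q = s then 1 else 0 := by
  rw [entry_apply]; exact Matrix.single_apply ..

theorem entry_lie (x y : nilpotentLiePosetAlgebra k P) (p q : P) :
    entry k p q ⁅x, y⁆ =
      ∑ r, (entry k p r x * entry k r q y - entry k p r y * entry k r q x) := by
  rw [entry_apply, LieSubalgebra.coe_bracket, Ring.lie_def, Matrix.sub_apply, Matrix.mul_apply,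
    Matrix.mul_apply, ← sum_sub_distrib]
  rfl

/-- Coordinates with respect to the matrix units. -/
noncomputable def coordEquiv (k P : Type*) [Field k] [Fintype P] [DecidableEq P] [PartialOrder P] :
    nilpotentLiePosetAlgebra k P ≃ₗ[k] (strictRel P → k) :=
  LinearEquiv.ofBijective (LinearMap.pi fun r : strictRel P => entry k r.1.1 r.1.2) <| by
    classical
    constructor
    · intro x y h
      refine ext_entry fun p q => ?_
      by_cases hpq : p < q
      · exact congrFun h ⟨(p, q), hpq⟩
      · rw [entry_eq_zero hpq, entry_eq_zero hpq]
    · intro c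
      refine ⟨⟨fun p q => if h : p < q then c ⟨(p, q), h⟩ else 0, fun p q h => dif_neg h⟩, ?_⟩
      ext ⟨⟨p, q⟩, h⟩
      exact dif_pos h

theorem finrank_nilpotentLiePosetAlgebra :
    Module.finrank k (nilpotentLiePosetAlgebra k P) = (strictRel P).ncard := by
  classical
  rw [(coordEquiv k P).finrank_eq, Module.finrank_fintype_fun_eq_card, ← Nat.card_eq_fintype_card]
  rfl

theorem exists_dual_eq_sum (F : Module.Dual k (nilpotentLiePosetAlgebra k P)) :
    ∃ c : P → P → k, ∀ x, F x = ∑ p, ∑ q, c p q * entry k p q x := by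
  classical
  refine ⟨fun p q => if h : p < q then F (unit k h) else 0, fun x => ?_⟩
  have hx : x = ∑ p, ∑ q, if h : p < q then entry k p q x • unit k h else 0 := by
    refine ext_entry fun r s => ?_
    simp only [map_sum]
    rw [sum_eq_single r, sum_eq_single s]
    · split_ifs with h
      · simp [entry_unit]
      · rw [entry_eq_zero h, map_zero]
    · intro q _ hq
      split_ifs <;> simp [entry_unit, hq]
    · simp
    · intro p _ hp
      refine sum_eq_zero fun q _ => ?_
      split_ifs <;> simp [entry_unit, hp]
    · simp
  conv_lhs => rw [hx]
  simp only [map_sum]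
  refine sum_congr rfl fun p _ => sum_congr rfl fun q _ => ?_
  split_ifs with h
  · rw [map_smul, smul_eq_mul, mul_comm]
  · simp

theorem kirillovForm_eq_sum {F : Module.Dual k (nilpotentLiePosetAlgebra k P)} {c : P → P → k}
    (hc : ∀ x, F x = ∑ p, ∑ q, c p q * entry k p q x) (x y : nilpotentLiePosetAlgebra k P) :
    kirillovForm F x y = ∑ r, (∑ p, entry k p r x * ∑ q, c p q * entry k r q y -
      ∑ q, entry k r q x * ∑ p, c p q * entry k p r y) := by
  have h1 : kirillovForm F x y = F ⁅x, y⁆ := rfl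
  rw [h1, hc]
  simp only [entry_lie, mul_sum, mul_sub, sum_sub_distrib]
  congr 1
  · rw [sum_congr rfl fun p _ => sum_comm, sum_comm]
    refine sum_congr rfl fun r _ => sum_congr rfl fun p _ => sum_congr rfl fun q _ => ?_
    ring
  · rw [sum_congr rfl fun p _ => sum_comm, sum_comm]
    refine sum_congr rfl fun r _ => ?_
    rw [sum_comm]
    refine sum_congr rfl fun q _ => sum_congr rfl fun p _ => ?_
    ring

theorem kirillovForm_unit {F : Module.Dual k (nilpotentLiePosetAlgebra k P)} {c : P → P → k}
    (hc : ∀ x, F x = ∑ p, ∑ q, c p q * entry k p q x) (x : nilpotentLiePosetAlgebra k P)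
    {r s : P} (h : r < s) :
    kirillovForm F x (unit k h) =
      ∑ p, c p s * entry k p r x - ∑ q, c r q * entry k s q x := by
  rw [kirillovForm_eq_sum hc]
  simp only [entry_unit, sum_sub_distrib]
  congr 1
  · rw [sum_eq_single r]
    · refine sum_congr rfl fun p _ => ?_
      simp [mul_comm]
    · intro t _ ht
      simp [ht.symm]
    · simp
  · rw [sum_eq_single s]
    · refine sum_congr rfl fun p _ => ?_
      simp [mul_comm]
    · intro t _ ht
      simp [ht.symm]
    · simp

/-! ### Lower bound for every kernel -/

theorem finrank_le_finrank_ker_kirillovForm (F : Module.Dual k (nilpotentLiePosetAlgebra k P)) :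
    (strictRel P).ncard ≤ Module.finrank k (LinearMap.ker (kirillovForm F)) +
      2 * ∑ p : P, min (numBelow p) (numAbove p) := by
  classical
  obtain ⟨c, hc⟩ := exists_dual_eq_sum F
  -- For each middle element, kill the entries of `x` on its smaller side, and the combinations of
  -- the other entries that pair with the entries of `y` on that side.
  let Φ : nilpotentLiePosetAlgebra k P →ₗ[k]
      ((Σ p : P, smallerSide p) ⊕ (Σ p : P, smallerSide p) → k) :=
    LinearMap.pi (Sum.elim
      (fun i => if numBelow i.1 ≤ numAbove i.1 then entry k i.2.1 i.1 else entry k i.1 i.2.1)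
      (fun i => if numBelow i.1 ≤ numAbove i.1 then ∑ q, c i.2.1 q • entry k i.1 q
        else ∑ p, c p i.2.1 • entry k p i.1))
  have hle : LinearMap.ker Φ ≤ LinearMap.ker (kirillovForm F) := by
    intro x hx
    rw [LinearMap.mem_ker] at hx
    have hl : ∀ (p t : P) (ht : t ∈ smallerSide p), _ := fun p t ht =>
      congrFun hx (Sum.inl ⟨p, t, ht⟩)
    have hr : ∀ (p t : P) (ht : t ∈ smallerSide p), _ := fun p t ht =>
      congrFun hx (Sum.inr ⟨p, t, ht⟩)
    simp only [Φ, LinearMap.pi_apply, Sum.elim_inl, Sum.elim_inr, Pi.zero_apply] at hl hr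
    rw [LinearMap.mem_ker]
    ext y
    rw [kirillovForm_eq_sum hc, LinearMap.zero_apply]
    refine sum_eq_zero fun r _ => ?_
    by_cases h : numBelow r ≤ numAbove r
    · have hmem : ∀ t, t < r → t ∈ smallerSide r := fun t ht => by simp [smallerSide, h, ht]
      have h1 : ∀ p, entry k p r x = 0 := fun p => by
        by_cases hp : p < r
        · simpa [h] using hl r p (hmem p hp)
        · exact entry_eq_zero hp x
      have h2 : ∀ p, entry k p r y * ∑ q, c p q * entry k r q x = 0 := fun p => by
        by_cases hp : p < r
        · have := hr r p (hmem p hp)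
          simp only [h, if_true, LinearMap.sum_apply, LinearMap.smul_apply, smul_eq_mul] at this
          rw [this, mul_zero]
        · rw [entry_eq_zero hp y, zero_mul]
      have h3 : ∑ q, entry k r q x * ∑ p, c p q * entry k p r y =
          ∑ p, entry k p r y * ∑ q, c p q * entry k r q x := by
        simp only [mul_sum]
        rw [sum_comm]
        exact sum_congr rfl fun _ _ => sum_congr rfl fun _ _ => by ring
      rw [h3, sum_eq_zero fun p _ => h2 p]
      simp [h1]
    · have hmem : ∀ t, r < t → t ∈ smallerSide r := fun t ht => by simp [smallerSide, h, ht]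
      have h1 : ∀ q, entry k r q x = 0 := fun q => by
        by_cases hq : r < q
        · simpa [h] using hl r q (hmem q hq)
        · exact entry_eq_zero hq x
      have h2 : ∀ q, entry k r q y * ∑ p, c p q * entry k p r x = 0 := fun q => by
        by_cases hq : r < q
        · have := hr r q (hmem q hq)
          simp only [h, if_false, LinearMap.sum_apply, LinearMap.smul_apply, smul_eq_mul] at this
          rw [this, mul_zero]
        · rw [entry_eq_zero hq y, zero_mul]
      have h3 : ∑ p, entry k p r x * ∑ q, c p q * entry k r q y =
          ∑ q, entry k r q y * ∑ p, c p q * entry k p r x := by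
        simp only [mul_sum]
        rw [sum_comm]
        exact sum_congr rfl fun _ _ => sum_congr rfl fun _ _ => by ring
      rw [h3, sum_eq_zero fun q _ => h2 q]
      simp [h1]
  have hrk := Φ.finrank_range_add_finrank_ker
  have hrange := Submodule.finrank_le (LinearMap.range Φ)
  have hker := Submodule.finrank_mono hle
  rw [Module.finrank_fintype_fun_eq_card, Fintype.card_sum, Fintype.card_sigma] at hrange
  simp only [Fintype.card_coe, card_smallerSide] at hrange
  rw [finrank_nilpotentLiePosetAlgebra] at hrk
  omega

/-! ### A Cauchy functional attaining the bound -/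

/-- An element of the kernel of the Kirillov form of a Cauchy functional vanishes as soon as it is
supported on a suitably chosen set of relations. -/
theorem eq_zero_of_mem_ker_of_support {F : Module.Dual k (nilpotentLiePosetAlgebra k P)}
    {f : P → k} (hf : Function.Injective f) (hne : ∀ a b, f a + f b ≠ 0)
    (hF : ∀ x, F x = ∑ p, ∑ q, (f p + f q)⁻¹ * entry k p q x) {A B : P → Finset P}
    (hA : ∀ p, ∀ a ∈ A p, a < p ∧ numBelow a < numAbove p)
    (hB : ∀ p, ∀ b ∈ B p, p < b ∧ numAbove b < numBelow p)
    (hAB : ∀ p, #(A p) = #(B p)) {x : nilpotentLiePosetAlgebra k P}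
    (hx : x ∈ LinearMap.ker (kirillovForm F))
    (hsupp : ∀ p q, p ∉ A q → q ∉ B p → entry k p q x = 0) : x = 0 := by
  have hrel : ∀ {r s : P}, r < s →
      ∑ p, (f p + f s)⁻¹ * entry k p r x = ∑ q, (f r + f q)⁻¹ * entry k s q x := by
    intro r s h
    rw [← sub_eq_zero, ← kirillovForm_unit hF x h, LinearMap.mem_ker.1 hx, LinearMap.zero_apply]
  -- Block `A p` has priority `potential p`, block `B p` has `-potential p`; blocks are cleared from
  -- the highest priority down.
  have key : ∀ n : ℕ,
      (∀ p, ∀ a ∈ A p, (Fintype.card P + 1 : ℤ) - n < potential p → entry k a p x = 0) ∧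
      (∀ p, ∀ b ∈ B p, (Fintype.card P + 1 : ℤ) - n < -potential p → entry k p b x = 0) := by
    intro n
    induction n with
    | zero =>
      refine ⟨fun p _ _ h => ?_, fun p _ _ h => ?_⟩
      · have := potential_le p; omega
      · have := le_potential p; omega
    | succ n ih =>
      push_cast
      refine ⟨fun p a ha h => ?_, fun p b hb h => ?_⟩
      · refine eq_zero_of_sum_cauchy_eq_zero hf hne (hAB p).le (v := fun a => entry k a p x)
          (fun b hb => ?_) a ha
        have hpb := hB p b hb
        have hs := hrel hpb.1
        -- Entries `(b, q)` with `q ∈ B b` are already cleared; `b ∈ A q` would give `numBelow b <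
        -- numAbove q < numAbove b < numBelow p < numBelow b`.
        rw [sum_eq_zero (f := fun q => (f p + f q)⁻¹ * entry k b q x)] at hs
        · rw [← hs]
          refine sum_subset (subset_univ _) fun c _ hc => ?_
          by_cases hcp : p ∈ B c
          · have h1 := hB c p hcp
            have := potential_add_neg h1.1 h1.2
            rw [ih.2 c p hcp (by omega), mul_zero]
          · rw [hsupp c p hc hcp, mul_zero]
        · intro q _
          by_cases hbq : q ∈ B b
          · have := potential_add_neg hpb.1 hpb.2
            rw [ih.2 b q hbq (by omega), mul_zero]
          · rw [hsupp b q _ hbq, mul_zero]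
            intro hq
            have h1 := hA q b hq
            have h2 := numAbove_lt_numAbove h1.1
            have h3 := numBelow_lt_numBelow hpb.1
            omega
      · refine eq_zero_of_sum_cauchy_eq_zero hf hne (hAB p).ge (v := fun b => entry k p b x)
          (fun a ha => ?_) b hb
        have hap := hA p a ha
        have hs := hrel hap.1
        rw [sum_eq_zero (f := fun c => (f c + f p)⁻¹ * entry k c a x)] at hs
        · rw [hs]
          simp only [add_comm _ (f a)]
          refine sum_subset (subset_univ _) fun q _ hq => ?_
          by_cases hpq : p ∈ A q
          · have h1 := hA q p hpq
            have := potential_add_pos h1.1 h1.2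
            rw [ih.1 q p hpq (by omega), mul_zero]
          · rw [hsupp p q hpq hq, mul_zero]
        · intro c _
          by_cases hca : c ∈ A a
          · have := potential_add_pos hap.1 hap.2
            rw [ih.1 a c hca (by omega), mul_zero]
          · rw [hsupp c a hca, mul_zero]
            intro hc
            have h1 := hB c a hc
            have h2 := numBelow_lt_numBelow h1.1
            have h3 := numAbove_lt_numAbove hap.1
            omega
  -- This takes the threshold below `-(card P + 1)`, the least possible priority.
  obtain ⟨k1, k2⟩ := key (2 * (Fintype.card P + 1) + 1)
  refine ext_entry fun p q => ?_
  rw [map_zero]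
  by_cases h1 : p ∈ A q
  · refine k1 q p h1 ?_
    have := le_potential q
    push_cast; omega
  · by_cases h2 : q ∈ B p
    · refine k2 p q h2 ?_
      have := potential_le p
      push_cast; omega
    · exact hsupp p q h1 h2

theorem exists_finrank_ker_kirillovForm_le (k P : Type*) [Field k] [CharZero k] [Fintype P]
    [DecidableEq P] [PartialOrder P] :
    ∃ F : Module.Dual k (nilpotentLiePosetAlgebra k P),
      Module.finrank k (LinearMap.ker (kirillovForm F)) +
        2 * ∑ p : P, min (numBelow p) (numAbove p) ≤ (strictRel P).ncard := by
  classical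
  choose A hA hAcard using fun p : P =>
    exists_finset_below p (min_le_left (numBelow p) (numAbove p))
  choose B hB hBcard using fun p : P =>
    exists_finset_above p (min_le_right (numBelow p) (numAbove p))
  replace hA : ∀ p, ∀ a ∈ A p, a < p ∧ numBelow a < numAbove p := fun p a ha =>
    ⟨(hA p a ha).1, (hA p a ha).2.trans_le (min_le_right _ _)⟩
  replace hB : ∀ p, ∀ b ∈ B p, p < b ∧ numAbove b < numBelow p := fun p b hb =>
    ⟨(hB p b hb).1, (hB p b hb).2.trans_le (min_le_left _ _)⟩
  -- Distinct positive integers: sums `f a + f b` are nonzero in characteristic zero, even for `a =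
  -- b`.
  let f : P → k := fun p => ((Fintype.equivFin P p : ℕ) + 1 : ℕ)
  have hf : Function.Injective f := fun p q h => by
    have h' : ((Fintype.equivFin P p : ℕ) + 1) = (Fintype.equivFin P q : ℕ) + 1 :=
      Nat.cast_injective h
    exact (Fintype.equivFin P).injective (Fin.ext (by omega))
  have hne : ∀ a b, f a + f b ≠ 0 := fun a b => by
    simp only [f]
    rw [← Nat.cast_add, Nat.cast_ne_zero]
    omega
  let F : Module.Dual k (nilpotentLiePosetAlgebra k P) :=
    ∑ p, ∑ q, (f p + f q)⁻¹ • entry k p q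
  have hF : ∀ x, F x = ∑ p, ∑ q, (f p + f q)⁻¹ * entry k p q x := fun x => by
    simp [F, LinearMap.sum_apply]
  refine ⟨F, ?_⟩
  let R : Finset (P × P) := univ.filter fun x => x.1 < x.2
  let SA : Finset (P × P) := univ.filter fun x => x.1 ∈ A x.2
  let SB : Finset (P × P) := univ.filter fun x => x.2 ∈ B x.1
  have hR : #R = (strictRel P).ncard := by
    rw [← Set.ncard_coe_finset]
    congr 1
    ext r
    simp [R, strictRel]
  have hSA : #SA = ∑ p : P, min (numBelow p) (numAbove p) := by
    simp only [SA, card_filter, Fintype.sum_prod_type_right, ← hAcard]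
    exact sum_congr rfl fun p _ => by simp
  have hSB : #SB = ∑ p : P, min (numBelow p) (numAbove p) := by
    simp only [SB, card_filter, Fintype.sum_prod_type, ← hBcard]
    exact sum_congr rfl fun p _ => by simp
  have hdisj : Disjoint SA SB := by
    rw [Finset.disjoint_left]
    rintro ⟨a, b⟩ h1 h2
    have h1' := hA b a (by simpa [SA] using h1)
    have h2' := hB a b (by simpa [SB] using h2)
    omega
  have hsub : SA ∪ SB ⊆ R := by
    rintro ⟨a, b⟩ h
    simp only [SA, SB, mem_union, mem_filter, mem_univ, true_and] at h
    simp only [R, mem_filter, mem_univ, true_and]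
    exact h.elim (fun h => (hA b a h).1) (fun h => (hB a b h).1)
  let Ψ : nilpotentLiePosetAlgebra k P →ₗ[k] ((R \ (SA ∪ SB) : Finset (P × P)) → k) :=
    LinearMap.pi fun r => entry k r.1.1 r.1.2
  have hinj : Function.Injective (Ψ ∘ₗ (LinearMap.ker (kirillovForm F)).subtype) := by
    rw [← LinearMap.ker_eq_bot, LinearMap.ker_eq_bot']
    rintro ⟨x, hx⟩ h
    rw [Submodule.mk_eq_zero]
    refine eq_zero_of_mem_ker_of_support hf hne hF hA hB
      (fun p => (hAcard p).trans (hBcard p).symm) hx fun p q h1 h2 => ?_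
    by_cases hpq : p < q
    · exact congrFun h ⟨(p, q), by simp [R, SA, SB, hpq, h1, h2]⟩
    · exact entry_eq_zero hpq x
  have hle := LinearMap.finrank_le_finrank_of_injective hinj
  rw [Module.finrank_fintype_fun_eq_card, Fintype.card_coe, card_sdiff_of_subset hsub] at hle
  have hcard := Finset.card_le_card hsub
  rw [card_union_of_disjoint hdisj] at hle hcard
  omega

theorem index_add_two_mul_sum (k P : Type*) [Field k] [CharZero k] [Fintype P]
    [DecidableEq P] [PartialOrder P] :
    index k (nilpotentLiePosetAlgebra k P) + 2 * ∑ p : P, min (numBelow p) (numAbove p) =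
      (strictRel P).ncard := by
  obtain ⟨F, hF⟩ := exists_finrank_ker_kirillovForm_le k P
  refine le_antisymm (le_trans (Nat.add_le_add_right (Nat.sInf_le (Set.mem_range_self F)) _) hF) ?_
  obtain ⟨G, hG⟩ := Nat.sInf_mem (Set.range_nonempty fun F : Module.Dual k
    (nilpotentLiePosetAlgebra k P) => Module.finrank k (LinearMap.ker (kirillovForm F)))
  rw [index, ← hG]
  exact finrank_le_finrank_ker_kirillovForm G

end Algebra

theorem min_numBelow_numAbove_eq_zero {P : Type*} [PartialOrder P] {p : P}
    (hp : p ∈ extremal P) :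
    min (numBelow p) (numAbove p) = 0 := by
  rcases hp with h | h
  · have : {q : P | q < p} = ∅ := Set.eq_empty_of_forall_notMem fun q hq => h.not_lt hq
    simp [numBelow, this]
  · have : {q : P | p < q} = ∅ := Set.eq_empty_of_forall_notMem fun q hq => h.not_lt hq
    simp [numAbove, this]

end LiePoset

theorem theorem3 (k : Type*) [Field k] [IsAlgClosed k] [CharZero k]
    (P : Type*) [Fintype P] [DecidableEq P] [PartialOrder P] :
    (LiePoset.index k (LiePoset.nilpotentLiePosetAlgebra k P) : ℤ) =
      ((LiePoset.strictRel P).ncard : ℤ) -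
        2 * ∑ p ∈ (Set.toFinite (LiePoset.extremal P)ᶜ).toFinset,
          (min (LiePoset.numBelow p) (LiePoset.numAbove p) : ℤ) := by
  have hsum : ∑ p ∈ (Set.toFinite (LiePoset.extremal P)ᶜ).toFinset,
      min (LiePoset.numBelow p) (LiePoset.numAbove p) =
      ∑ p : P, min (LiePoset.numBelow p) (LiePoset.numAbove p) := by
    refine Finset.sum_subset (Finset.subset_univ _) fun p _ hp => ?_
    exact LiePoset.min_numBelow_numAbove_eq_zero (by simpa using hp)
  rw [← LiePoset.index_add_two_mul_sum k P, ← hsum]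
  push_cast
  ring
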